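/- Let $\Gamma$ be a nonempty finite connected graph (loops and multiple edges allowed) underlying a graph of groups in which every vertex group $G_a$ and every edge group $G_e$ is infinite cyclic, with injective inclusions of each edge group into the groups of its two endpoints. Let $T$ be a spanning tree of $\Gamma$ and let $G$ be the fundamental group of the graph of groups with respect to $T$ (a generalized Baumslag–Solitar group), that is, the quotient of the free product of all $G_a$ and of the free group on letters $t_e$, one for each edge $e$ with a fixed orientation, by the relations $t_e^{-1}\lambda_e(g)\,t_e=\rho_e(g)$ for $g\in G_e$, where $\lambda_e,\rho_e$ are the inclusions of $G_e$ into the groups of the initial and the terminal vertex of $e$, and $t_e=1$ for $e\in T$. Choose a generator of each vertex group and of each edge group, so that for every oriented edge $e$ the inclusions of $G_e$ into the groups of the initial and the terminal vertex of $e$ are multiplication by nonzero integers $n_e$ and $m_e$, respectively (reversing $e$ exchanges $n_e$ and $m_e$). Call a loop, that is, a sequence $e_1,\dots,e_p$ ($p\ge 1$) of oriented edges forming a closed path, unimodular if $\left|\prod_{j=1}^p m_{e_j}\right|=\left|\prod_{j=1}^p n_{e_j}\right|$, and call $G$ unimodular (with respect to the given graph of groups) if all loops are unimodular. Let $a$ be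 any vertex and let $x\in G$ be the image of the chosen generator of $G_a$. Then $G$ is unimodular if and only if $\langle x^k\rangle$ is a normal subgroup of $G$ for some integer $k\ge 1$. -/

import Mathlib

universe u v w z

/-- A graph of groups with vertex set `V` and set of (geometric) edges `E`. Each edge carries a
reference orientation from `src e` to `tgt e`; loops and multiple edges are allowed. Each edge group
is embedded in the groups of both endpoints. -/
structure GraphOfGroups (V : Type u) (E : Type v) where
  src : E → V
  tgt : E → V
  vertexGroup : V → Type w
  edgeGroup : E → Type z
  [vertexGroupInst : ∀ a, Group (vertexGroup a)]
  [edgeGroupInst : ∀ e, Group (edgeGroup e)]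
  /-- The left inclusion, into the group of the source. -/
  left : ∀ e, edgeGroup e →* vertexGroup (src e)
  /-- The right inclusion, into the group of the target. -/
  right : ∀ e, edgeGroup e →* vertexGroup (tgt e)
  left_injective : ∀ e, Function.Injective (left e)
  right_injective : ∀ e, Function.Injective (right e)

attribute [instance] GraphOfGroups.vertexGroupInst GraphOfGroups.edgeGroupInst

namespace GraphOfGroups

variable {V : Type u} {E : Type v}

/-! ### Paths in the underlying graph

An oriented edge is a pair `(e, b)`: the edge `e` with its reference orientation if `b = true`, and
with the opposite orientation if `b = false`. -/

/-- Origin of an oriented edge. -/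
def origin (Γ : GraphOfGroups.{u, v, w, z} V E) : E × Bool → V
  | (e, true) => Γ.src e
  | (e, false) => Γ.tgt e

/-- Terminus of an oriented edge. -/
def terminus (Γ : GraphOfGroups.{u, v, w, z} V E) : E × Bool → V
  | (e, true) => Γ.tgt e
  | (e, false) => Γ.src e

/-- `Γ.IsPath a l b`: the oriented edges of `l` form, in this order, a path from `a` to `b`. -/
inductive IsPath (Γ : GraphOfGroups.{u, v, w, z} V E) : V → List (E × Bool) → V → Prop
  | nil (a : V) : IsPath Γ a [] a
  | cons (d : E × Bool) (l : List (E × Bool)) (b : V) :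
      IsPath Γ (Γ.terminus d) l b → IsPath Γ (Γ.origin d) (d :: l) b

/-- A path is reduced if no oriented edge is followed by the same edge in the opposite direction. -/
def IsReduced (l : List (E × Bool)) : Prop :=
  l.IsChain fun d d' => d' ≠ (d.1, !d.2)

/-- The underlying graph is connected (and nonempty). -/
def IsConnected (Γ : GraphOfGroups.{u, v, w, z} V E) : Prop :=
  Nonempty V ∧ ∀ a b : V, ∃ l, Γ.IsPath a l b

/-- The edges of `T`, with all the vertices, form a tree: any two vertices are joined by exactly one
reduced path with edges in `T`. -/
def IsSpanningTree (Γ : GraphOfGroups.{u, v, w, z} V E) (T : Set E) : Prop :=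
  ∀ a b : V, ∃! l : List (E × Bool), Γ.IsPath a l b ∧ IsReduced l ∧ ∀ d ∈ l, d.1 ∈ T

/-- A loop: a sequence of `p ≥ 1` oriented edges forming a closed path. -/
def IsLoop (Γ : GraphOfGroups.{u, v, w, z} V E) (l : List (E × Bool)) : Prop :=
  l ≠ [] ∧ ∃ a, Γ.IsPath a l a

/-! ### The fundamental group -/

/-- The free product of all vertex groups and of the free group on the stable letters `t_e`. -/
abbrev PreGroup (Γ : GraphOfGroups.{u, v, w, z} V E) : Type (max u v w) :=
  Monoid.Coprod (Monoid.CoprodI Γ.vertexGroup) (FreeGroup E)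

/-- Inclusion of the vertex group at `a` in the free product. -/
def preVertex (Γ : GraphOfGroups.{u, v, w, z} V E) (a : V) : Γ.vertexGroup a →* Γ.PreGroup :=
  (Monoid.Coprod.inl).comp Monoid.CoprodI.of

/-- The stable letter `t_e` in the free product. -/
def preStable (Γ : GraphOfGroups.{u, v, w, z} V E) (e : E) : Γ.PreGroup :=
  Monoid.Coprod.inr (FreeGroup.of e)

/-- The defining relators: `t_e⁻¹ (left e g) t_e = right e g` for every edge `e` and every `g` in its
edge group, and `t_e = 1` for every edge `e` of the spanning tree `T`. -/
inductive IsRelator (Γ : GraphOfGroups.{u, v, w, z} V E) (T : Set E) : Γ.PreGroup → Prop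
  | conj (e : E) (g : Γ.edgeGroup e) : IsRelator Γ T
      ((Γ.preStable e)⁻¹ * Γ.preVertex (Γ.src e) (Γ.left e g) * Γ.preStable e *
        (Γ.preVertex (Γ.tgt e) (Γ.right e g))⁻¹)
  | tree (e : E) (he : e ∈ T) : IsRelator Γ T (Γ.preStable e)

/-- The fundamental group of the graph of groups with respect to the spanning tree `T`. -/
abbrev Pi1 (Γ : GraphOfGroups.{u, v, w, z} V E) (T : Set E) : Type (max u v w) :=
  Γ.PreGroup ⧸ Subgroup.normalClosure {r | Γ.IsRelator T r}

/-- The canonical homomorphism from the vertex group at `a` to the fundamental group. -/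
def ofVertex (Γ : GraphOfGroups.{u, v, w, z} V E) (T : Set E) (a : V) :
    Γ.vertexGroup a →* Γ.Pi1 T :=
  (QuotientGroup.mk' (Subgroup.normalClosure {r | Γ.IsRelator T r})).comp (Γ.preVertex a)

/-! ### Generalized Baumslag-Solitar groups -/

/-- A finite connected graph of groups all of whose vertex and edge groups are infinite cyclic; its
fundamental group is a generalized Baumslag-Solitar group. -/
structure IsGBS (Γ : GraphOfGroups.{u, v, w, z} V E) : Prop where
  finite_vertices : Finite V
  finite_edges : Finite E
  connected : Γ.IsConnected
  vertex_cyclic : ∀ a, IsCyclic (Γ.vertexGroup a)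
  vertex_infinite : ∀ a, Infinite (Γ.vertexGroup a)
  edge_cyclic : ∀ e, IsCyclic (Γ.edgeGroup e)
  edge_infinite : ∀ e, Infinite (Γ.edgeGroup e)

/-- A choice of a generator for each (cyclic) vertex group and each (cyclic) edge group, with the
integers `leftLabel e`, `rightLabel e` by which the left and right inclusions of `e` multiply
once the groups are identified with `ℤ` through these generators. -/
structure Labelling (Γ : GraphOfGroups.{u, v, w, z} V E) where
  vertexGen : ∀ a, Γ.vertexGroup a
  edgeGen : ∀ e, Γ.edgeGroup e
  vertexGen_generates : ∀ a, Subgroup.zpowers (vertexGen a) = ⊤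
  edgeGen_generates : ∀ e, Subgroup.zpowers (edgeGen e) = ⊤
  leftLabel : E → ℤ
  rightLabel : E → ℤ
  left_edgeGen : ∀ e, Γ.left e (edgeGen e) = vertexGen (Γ.src e) ^ leftLabel e
  right_edgeGen : ∀ e, Γ.right e (edgeGen e) = vertexGen (Γ.tgt e) ^ rightLabel e

namespace Labelling

variable {Γ : GraphOfGroups.{u, v, w, z} V E}

/-- Label of an oriented edge at its origin: the integer `n` of its left inclusion. -/
def originLabel (L : Γ.Labelling) : E × Bool → ℤ
  | (e, true) => L.leftLabel e
  | (e, false) => L.rightLabel e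

/-- Label of an oriented edge at its terminus: the integer `m` of its right inclusion. -/
def terminusLabel (L : Γ.Labelling) : E × Bool → ℤ
  | (e, true) => L.rightLabel e
  | (e, false) => L.leftLabel e

/-- The sequence of oriented edges `l` satisfies `|∏ m_j| = |∏ n_j|`. -/
def IsUnimodularLoop (L : Γ.Labelling) (l : List (E × Bool)) : Prop :=
  |(l.map L.terminusLabel).prod| = |(l.map L.originLabel).prod|

/-- The graph of groups is unimodular: all its loops are. -/
def IsUnimodular (L : Γ.Labelling) : Prop :=
  ∀ l, Γ.IsLoop l → L.IsUnimodularLoop l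

end Labelling

end GraphOfGroups

namespace GraphOfGroups

/-! ### Paths -/

section Paths

variable {V : Type u} {E : Type v} {Γ : GraphOfGroups.{u, v, w, z} V E}

/-! Write `x_b` for the image of the generator at `b`. Crossing an oriented edge conjugates `x ^ (n
* c)` at its origin to `x ^ (m * c)` at its terminus, so a loop at `b` conjugates `x_b ^ (∏ n * c)`
to `x_b ^ (∏ m * c)`. If `⟨x_a ^ k⟩` is normal, conjugation acts on it by `±1`. It contains a
nontrivial power of `x_b`, and `x_b` has infinite order (`gen_zpow_injective`, by an affine action
on `ℚ` instead of normal forms), so `∏ m = ± ∏ n`. Conversely, unimodularity makes `∏ |n / m|` along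
a path depend only on its endpoints. Clearing denominators yields exponents `N b` such that each
stable letter carries `⟨x_b ^ N b⟩` at its source to the one at its target. Since `t_e = 1` on the
tree, these subgroups coincide, and all generators normalize the result. -/

theorem IsPath.append {a b c : V} {l l' : List (E × Bool)} (h : Γ.IsPath a l b)
    (h' : Γ.IsPath b l' c) : Γ.IsPath a (l ++ l') c := by
  induction h with
  | nil a => exact h'
  | cons d l b _ ih => exact IsPath.cons d _ _ (ih h')

/-- On a tree, the path from a vertex to the root determines every function on the edges as a
multiplicative coboundary. -/
theorem IsSpanningTree.exists_potential {T : Set E} (hT : Γ.IsSpanningTree T) [Nonempty V]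
    (r : E → ℚ) (hr : ∀ e, r e ≠ 0) :
    ∃ f : V → ℚ, (∀ b, f b ≠ 0) ∧ ∀ e ∈ T, f (Γ.src e) = r e * f (Γ.tgt e) := by
  obtain ⟨a⟩ := ‹Nonempty V›
  choose l hl huniq using fun b => hT b a
  let s : E × Bool → ℚ := fun d => if d.2 then r d.1 else (r d.1)⁻¹
  refine ⟨fun b => ((l b).map s).prod, fun b => ?_, fun e he => ?_⟩
  · refine List.prod_ne_zero fun h => ?_
    obtain ⟨⟨e, o⟩, -, h⟩ := List.mem_map.1 h
    cases o <;> simp [s, hr] at h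
  · obtain ⟨hp, hred, hmem⟩ := hl (Γ.tgt e)
    -- Either `e` extends the reduced path from its target, or that path starts by backtracking
    -- along `e` and its tail is the reduced path from the source.
    by_cases hc : IsReduced ((e, true) :: l (Γ.tgt e))
    · have := huniq (Γ.src e) ((e, true) :: l (Γ.tgt e))
        ⟨IsPath.cons (e, true) _ _ hp, hc, by
          rintro d (_ | ⟨_, hd⟩)
          exacts [he, hmem d hd]⟩
      simp only [← this, List.map_cons, List.prod_cons]
      simp [s]
    · generalize hL : l (Γ.tgt e) = L at *
      cases L with
      | nil => exact absurd (List.isChain_singleton _) hc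
      | cons d L =>
        have hd : d = (e, false) := by
          by_contra hne
          exact hc (List.isChain_cons_cons.2 ⟨hne, hred⟩)
        subst hd
        have hp' : Γ.IsPath (Γ.src e) L a := by
          generalize hq : Γ.tgt e = q at hp
          cases hp with
          | cons _ _ _ h => exact h
        have := huniq (Γ.src e) L
          ⟨hp', List.IsChain.of_cons hred, fun d hd => hmem d (List.mem_cons_of_mem _ hd)⟩
        simp only [← this, hL, List.map_cons, List.prod_cons]
        simp [s, hr]

end Paths

/-! ### The fundamental group: generators, relations, universal property -/

section Presentation

variable {V : Type u} {E : Type v} (Γ : GraphOfGroups.{u, v, w, z} V E) (T : Set E)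

/-- The image of the stable letter `t_e` in the fundamental group. -/
def ofStable (e : E) : Γ.Pi1 T :=
  QuotientGroup.mk' (Subgroup.normalClosure {r | Γ.IsRelator T r}) (Γ.preStable e)

variable {Γ T}

theorem conj_ofStable (e : E) (g : Γ.edgeGroup e) :
    (Γ.ofStable T e)⁻¹ * Γ.ofVertex T (Γ.src e) (Γ.left e g) * Γ.ofStable T e =
      Γ.ofVertex T (Γ.tgt e) (Γ.right e g) := by
  have h := (QuotientGroup.eq_one_iff (N := Subgroup.normalClosure {r | Γ.IsRelator T r}) _).2
    (Subgroup.subset_normalClosure (IsRelator.conj e g))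
  exact mul_inv_eq_one.1 h

theorem ofStable_eq_one {e : E} (he : e ∈ T) : Γ.ofStable T e = 1 :=
  (QuotientGroup.eq_one_iff (N := Subgroup.normalClosure {r | Γ.IsRelator T r}) _).2
    (Subgroup.subset_normalClosure (IsRelator.tree e he))

theorem mem_of_generators_mem {K : Subgroup (Γ.Pi1 T)}
    (hv : ∀ a g, Γ.ofVertex T a g ∈ K) (he : ∀ e, Γ.ofStable T e ∈ K) (g : Γ.Pi1 T) : g ∈ K := by
  obtain ⟨p, rfl⟩ := QuotientGroup.mk'_surjective _ g
  induction p using Monoid.Coprod.induction_on with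
  | inl m =>
    induction m using Monoid.CoprodI.induction_on with
    | one => simp
    | of i m => exact hv i m
    | mul x y hx hy =>
      rw [map_mul, map_mul]
      exact K.mul_mem hx hy
  | inr n =>
    induction n using FreeGroup.induction_on with
    | C1 => simp
    | of e => exact he e
    | inv_of e h =>
      rw [map_inv, map_inv]
      exact K.inv_mem h
    | mul x y hx hy =>
      rw [map_mul, map_mul]
      exact K.mul_mem hx hy
  | mul x y hx hy =>
    rw [map_mul]
    exact K.mul_mem hx hy

theorem exists_lift {H : Type*} [Group H] (φ : ∀ a, Γ.vertexGroup a →* H) (t : E → H)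
    (hconj : ∀ e g, (t e)⁻¹ * φ _ (Γ.left e g) * t e = φ _ (Γ.right e g))
    (htree : ∀ e ∈ T, t e = 1) :
    ∃ Φ : Γ.Pi1 T →* H, ∀ a g, Φ (Γ.ofVertex T a g) = φ a g := by
  let Ψ : Γ.PreGroup →* H := Monoid.Coprod.lift (Monoid.CoprodI.lift φ) (FreeGroup.lift t)
  have hΨv : ∀ a g, Ψ (Γ.preVertex a g) = φ a g := fun a g => by simp [Ψ, preVertex]
  have hΨe : ∀ e, Ψ (Γ.preStable e) = t e := fun e => by simp [Ψ, preStable]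
  have hker : Subgroup.normalClosure {r | Γ.IsRelator T r} ≤ Ψ.ker := by
    refine Subgroup.normalClosure_le_normal ?_
    rintro _ (⟨e, g⟩ | ⟨e, he⟩)
    · simp only [SetLike.mem_coe, MonoidHom.mem_ker, map_mul, map_inv, hΨv, hΨe]
      rw [hconj, mul_inv_cancel]
    · simp only [SetLike.mem_coe, MonoidHom.mem_ker, hΨe]
      exact htree e he
  exact ⟨QuotientGroup.lift _ Ψ hker, fun a g => hΨv a g⟩

end Presentation

/-! ### Labels -/

namespace Labelling

variable {V : Type u} {E : Type v} {Γ : GraphOfGroups.{u, v, w, z} V E} (L : Γ.Labelling)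

theorem mem_zpowers_vertexGen (a : V) (g : Γ.vertexGroup a) :
    g ∈ Subgroup.zpowers (L.vertexGen a) :=
  L.vertexGen_generates a ▸ Subgroup.mem_top g

theorem mem_zpowers_edgeGen (e : E) (g : Γ.edgeGroup e) : g ∈ Subgroup.zpowers (L.edgeGen e) :=
  L.edgeGen_generates e ▸ Subgroup.mem_top g

theorem vertexGen_zpow_injective (hΓ : Γ.IsGBS) (a : V) :
    Function.Injective fun n : ℤ => L.vertexGen a ^ n := by
  have := hΓ.vertex_infinite a
  rw [injective_zpow_iff_not_isOfFinOrder, ← orderOf_eq_zero_iff]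
  exact Infinite.orderOf_eq_zero_of_forall_mem_zpowers (L.mem_zpowers_vertexGen a)

theorem edgeGen_ne_one (hΓ : Γ.IsGBS) (e : E) : L.edgeGen e ≠ 1 := by
  have := hΓ.edge_infinite e
  intro h
  have := Infinite.orderOf_eq_zero_of_forall_mem_zpowers (L.mem_zpowers_edgeGen e)
  simp [h] at this

theorem leftLabel_ne_zero (hΓ : Γ.IsGBS) (e : E) : L.leftLabel e ≠ 0 := fun h =>
  L.edgeGen_ne_one hΓ e <| Γ.left_injective e <| by rw [L.left_edgeGen, h, zpow_zero, map_one]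

theorem rightLabel_ne_zero (hΓ : Γ.IsGBS) (e : E) : L.rightLabel e ≠ 0 := fun h =>
  L.edgeGen_ne_one hΓ e <| Γ.right_injective e <| by rw [L.right_edgeGen, h, zpow_zero, map_one]

theorem originLabel_ne_zero (hΓ : Γ.IsGBS) : ∀ d, L.originLabel d ≠ 0
  | (e, true) => L.leftLabel_ne_zero hΓ e
  | (e, false) => L.rightLabel_ne_zero hΓ e

theorem terminusLabel_ne_zero (hΓ : Γ.IsGBS) : ∀ d, L.terminusLabel d ≠ 0
  | (e, true) => L.rightLabel_ne_zero hΓ e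
  | (e, false) => L.leftLabel_ne_zero hΓ e

/-- The image in the fundamental group of the generator of a vertex group. -/
def gen (T : Set E) (a : V) : Γ.Pi1 T :=
  Γ.ofVertex T a (L.vertexGen a)

variable (T : Set E)

theorem ofVertex_mem_zpowers_gen (a : V) (g : Γ.vertexGroup a) :
    Γ.ofVertex T a g ∈ Subgroup.zpowers (L.gen T a) := by
  obtain ⟨n, rfl⟩ := L.mem_zpowers_vertexGen a g
  exact ⟨n, by simp [gen]⟩

theorem conj_gen_zpow (e : E) (c : ℤ) :
    (Γ.ofStable T e)⁻¹ * L.gen T (Γ.src e) ^ (L.leftLabel e * c) * Γ.ofStable T e =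
      L.gen T (Γ.tgt e) ^ (L.rightLabel e * c) := by
  have := conj_ofStable (T := T) e (L.edgeGen e ^ c)
  simpa only [map_zpow, L.left_edgeGen, L.right_edgeGen, ← zpow_mul, gen] using this

theorem exists_conj_gen_zpow (d : E × Bool) (c : ℤ) :
    ∃ t, t⁻¹ * L.gen T (Γ.origin d) ^ (L.originLabel d * c) * t =
      L.gen T (Γ.terminus d) ^ (L.terminusLabel d * c) := by
  obtain ⟨e, _ | _⟩ := d
  · refine ⟨(Γ.ofStable T e)⁻¹, ?_⟩
    have := L.conj_gen_zpow T e c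
    simp only [originLabel, terminusLabel, origin, terminus]
    rw [← this]
    group
  · exact ⟨Γ.ofStable T e, L.conj_gen_zpow T e c⟩

/-- The free factor `c` carries the induction: it absorbs the labels of the edges already crossed or
still ahead. -/
theorem exists_conj_gen_zpow_of_isPath {a b : V} {l : List (E × Bool)} (h : Γ.IsPath a l b)
    (c : ℤ) :
    ∃ t, t⁻¹ * L.gen T a ^ ((l.map L.originLabel).prod * c) * t =
      L.gen T b ^ ((l.map L.terminusLabel).prod * c) := by
  induction h generalizing c with
  | nil a => exact ⟨1, by simp⟩
  | cons d l b _ ih =>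
    obtain ⟨t, ht⟩ := L.exists_conj_gen_zpow T d ((l.map L.originLabel).prod * c)
    obtain ⟨s, hs⟩ := ih (L.terminusLabel d * c)
    refine ⟨t * s, ?_⟩
    simp only [List.map_cons, List.prod_cons]
    rw [mul_assoc (L.originLabel d), mul_comm (L.terminusLabel d), mul_assoc _ (L.terminusLabel d),
      ← hs, mul_left_comm _ (L.terminusLabel d), ← ht]
    group

/-! ### The generators have infinite order -/

theorem exists_vertexGroup_hom (hΓ : Γ.IsGBS) (a : V) {H : Type*} [Group H] (h : H) :
    ∃ φ : Γ.vertexGroup a →* H, φ (L.vertexGen a) = h := by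
  let ψ : Multiplicative ℤ ≃* Γ.vertexGroup a :=
    MulEquiv.ofBijective (zpowersHom _ (L.vertexGen a))
      ⟨fun m n hmn => L.vertexGen_zpow_injective hΓ a hmn, fun g => by
        obtain ⟨n, hn⟩ := L.mem_zpowers_vertexGen a g
        exact ⟨Multiplicative.ofAdd n, hn⟩⟩
  refine ⟨(zpowersHom H h).comp ψ.symm.toMonoidHom, ?_⟩
  have : ψ.symm (L.vertexGen a) = Multiplicative.ofAdd 1 := by
    rw [MulEquiv.symm_apply_eq]
    exact (zpow_one _).symm
  simp [this]

theorem _root_.Equiv.zpow_addRight_rat (r : ℚ) (n : ℤ) :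
    (Equiv.addRight r : Equiv.Perm ℚ) ^ n = Equiv.addRight (n * r) := by
  have h1 : ∀ x y : ℚ, (Equiv.addRight x * Equiv.addRight y : Equiv.Perm ℚ) =
      Equiv.addRight (x + y) := fun x y => by
    ext q
    simp only [Equiv.Perm.mul_apply, Equiv.coe_addRight]
    ring
  induction n using Int.induction_on with
  | zero => ext; simp
  | succ n ih =>
    rw [zpow_add_one, ih, h1]
    push_cast
    ring_nf
  | pred n ih =>
    rw [zpow_sub_one, ih, mul_inv_eq_iff_eq_mul, h1]
    push_cast
    ring_nf

/-- The fundamental group acts on `ℚ` by affine maps, vertex generators acting by nontrivial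
translations; hence these have infinite order. -/
theorem gen_zpow_injective (hΓ : Γ.IsGBS) {T : Set E} (hT : Γ.IsSpanningTree T) (a : V) :
    Function.Injective fun n : ℤ => L.gen T a ^ n := by
  have hl : ∀ e, (L.leftLabel e : ℚ) ≠ 0 := fun e => by exact_mod_cast L.leftLabel_ne_zero hΓ e
  have hr : ∀ e, (L.rightLabel e : ℚ) ≠ 0 := fun e => by exact_mod_cast L.rightLabel_ne_zero hΓ e
  have : Nonempty V := ⟨a⟩
  -- The translation lengths `f` must agree across tree edges, where the stable letter acts
  -- trivially.
  obtain ⟨f, hf, hfT⟩ := hT.exists_potential (fun e => (L.rightLabel e / L.leftLabel e : ℚ))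
    fun e => div_ne_zero (hr e) (hl e)
  choose φ hφ using fun b => L.exists_vertexGroup_hom hΓ b (Equiv.addRight (f b))
  have hφn : ∀ b (n : ℤ), φ b (L.vertexGen b ^ n) = Equiv.addRight (n * f b) := fun b n => by
    rw [map_zpow, hφ, Equiv.zpow_addRight_rat]
  -- The scaling factor by which `t_e` must act, as the ratio of the two translations it conjugates;
  -- it is `1` on `T`.
  have hs : ∀ e, (L.leftLabel e * f (Γ.src e)) / (L.rightLabel e * f (Γ.tgt e)) ≠ 0 := fun e =>
    div_ne_zero (mul_ne_zero (hl e) (hf _)) (mul_ne_zero (hr e) (hf _))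
  obtain ⟨Φ, hΦ⟩ := exists_lift (T := T) φ (fun e => Equiv.mulRight₀ _ (hs e))
    (by
      intro e g
      obtain ⟨n, rfl⟩ := L.mem_zpowers_edgeGen e g
      simp only [map_zpow, L.left_edgeGen, L.right_edgeGen]
      rw [← zpow_mul, ← zpow_mul, ← map_zpow, ← map_zpow, hφn, hφn, mul_assoc,
        inv_mul_eq_iff_eq_mul]
      ext y
      have := hl e
      have := hr e
      have := hf (Γ.src e)
      have := hf (Γ.tgt e)
      simp only [Equiv.Perm.mul_apply, Equiv.coe_addRight, Equiv.mulRight₀_apply]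
      push_cast
      field_simp)
    (by
      intro e he
      have := hl e
      have := hr e
      have := hf (Γ.tgt e)
      ext y
      simp only [hfT e he, Equiv.mulRight₀_apply, Equiv.Perm.one_apply]
      field_simp)
  intro m n hmn
  have h := congrArg Φ hmn
  simp only [gen, ← map_zpow, hΦ, hφn] at h
  have h0 := Equiv.congr_fun h 0
  simp only [Equiv.coe_addRight, zero_add] at h0
  exact_mod_cast mul_right_cancel₀ (hf a) h0

/-! ### A normal cyclic subgroup forces unimodularity -/

/-- Conjugation acts on an infinite cyclic normal subgroup by `±1`. -/
theorem _root_.Subgroup.conj_eq_or_eq_inv_of_normal_zpowers {G : Type*} [Group G] {x : G}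
    (hx : Function.Injective fun n : ℤ => x ^ n) (hN : (Subgroup.zpowers x).Normal) (g : G) :
    g⁻¹ * x * g = x ∨ g⁻¹ * x * g = x⁻¹ := by
  obtain ⟨i, hi⟩ := Subgroup.mem_zpowers_iff.1
    (hN.conj_mem x (Subgroup.mem_zpowers x) g⁻¹)
  obtain ⟨j, hj⟩ := Subgroup.mem_zpowers_iff.1 (hN.conj_mem x (Subgroup.mem_zpowers x) g)
  rw [inv_inv] at hi
  -- Conjugations by `g` and `g⁻¹` undo each other, so their exponents are units of `ℤ`.
  have hij : i * j = 1 := hx <| by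
    have : (g⁻¹ * x * g) ^ j = x := by
      have := conj_zpow (a := g⁻¹) (b := x) (i := j)
      rw [inv_inv] at this
      rw [this, hj]
      group
    simpa only [zpow_mul, zpow_one, hi] using this
  rcases Int.eq_one_or_neg_one_of_mul_eq_one hij with rfl | rfl
  · left; rw [← hi, zpow_one]
  · right; rw [← hi, zpow_neg_one]

theorem isUnimodular_of_normal (hΓ : Γ.IsGBS) {T : Set E} (hT : Γ.IsSpanningTree T) {a : V}
    {k : ℕ} (hk : 1 ≤ k) (hN : (Subgroup.zpowers (L.gen T a ^ k)).Normal) : L.IsUnimodular := by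
  rintro l ⟨-, b, hl⟩
  obtain ⟨c, hc⟩ := hΓ.connected.2 a b
  have hk' : (k : ℤ) ≠ 0 := by omega
  have hinj : Function.Injective fun n : ℤ => (L.gen T a ^ k) ^ n := fun m n hmn => by
    simp only [← zpow_natCast, ← zpow_mul] at hmn
    exact mul_left_cancel₀ hk' (L.gen_zpow_injective hΓ hT a hmn)
  have key : ∀ g (n : ℤ), g⁻¹ * L.gen T a ^ (n * k) * g = L.gen T a ^ (n * k) ∨
      g⁻¹ * L.gen T a ^ (n * k) * g = (L.gen T a ^ (n * k))⁻¹ := fun g n => by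
    have e1 := conj_zpow (a := g⁻¹) (b := L.gen T a ^ k) (i := n)
    rw [inv_inv] at e1
    rw [mul_comm n, zpow_mul, zpow_natCast, ← e1, ← inv_zpow]
    rcases Subgroup.conj_eq_or_eq_inv_of_normal_zpowers hinj hN g with h | h <;> rw [h] <;> simp
  -- The loop is based at `b`, not `a`; a path from `a` puts a nonzero power `x_b ^ j` inside `⟨x_a
  -- ^ k⟩`.
  obtain ⟨t, ht⟩ := L.exists_conj_gen_zpow_of_isPath T hc k
  set j : ℤ := (c.map L.terminusLabel).prod * k with hj
  have hj0 : j ≠ 0 := mul_ne_zero (List.prod_ne_zero fun h => by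
    obtain ⟨d, -, hd⟩ := List.mem_map.1 h
    exact L.terminusLabel_ne_zero hΓ d hd) hk'
  obtain ⟨i, hi⟩ : ∃ i : ℤ, L.gen T b ^ j = L.gen T a ^ (i * k) := by
    rcases key t (c.map L.originLabel).prod with h | h
    · exact ⟨_, ht.symm.trans h⟩
    · exact ⟨-(c.map L.originLabel).prod, by rw [← ht, h, neg_mul, zpow_neg]⟩
  obtain ⟨s, hs⟩ := L.exists_conj_gen_zpow_of_isPath T hl j
  have h2 : L.gen T b ^ ((l.map L.originLabel).prod * j) =
      L.gen T a ^ (i * (l.map L.originLabel).prod * k) := by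
    rw [mul_comm, zpow_mul, hi, ← zpow_mul]
    congr 1
    ring
  have hcases := key s (i * (l.map L.originLabel).prod)
  rw [← h2, hs, ← zpow_neg, ← neg_mul] at hcases
  rcases hcases with h | h
  · exact congrArg abs (mul_right_cancel₀ hj0 (L.gen_zpow_injective hΓ hT b h))
  · have := mul_right_cancel₀ hj0 (L.gen_zpow_injective hΓ hT b h)
    rw [IsUnimodularLoop, this, abs_neg]

/-! ### Unimodularity yields a normal cyclic subgroup -/

/-- The modulus of a sequence of oriented edges. -/
def modulus (l : List (E × Bool)) : ℚ :=
  (l.map fun d => |(L.originLabel d : ℚ) / L.terminusLabel d|).prod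

theorem modulus_append (l l' : List (E × Bool)) :
    L.modulus (l ++ l') = L.modulus l * L.modulus l' := by
  simp [modulus]

theorem modulus_eq (l : List (E × Bool)) : L.modulus l =
    |((l.map L.originLabel).prod : ℚ)| / |((l.map L.terminusLabel).prod : ℚ)| := by
  induction l with
  | nil => simp [modulus]
  | cons d l ih =>
    rw [modulus, List.map_cons, List.prod_cons, ← modulus, ih]
    simp only [List.map_cons, List.prod_cons, Int.cast_mul, abs_mul, abs_div]
    rw [mul_div_mul_comm]

theorem modulus_eq_one_of_isUnimodular (hΓ : Γ.IsGBS) (hL : L.IsUnimodular) {a : V}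
    {l : List (E × Bool)} (hl : Γ.IsPath a l a) : L.modulus l = 1 := by
  by_cases h0 : l = []
  · simp [h0, modulus]
  have h := hL l ⟨h0, a, hl⟩
  rw [IsUnimodularLoop] at h
  have h' : |((l.map L.terminusLabel).prod : ℚ)| = |((l.map L.originLabel).prod : ℚ)| := by
    exact_mod_cast h
  rw [modulus_eq, ← h', div_self]
  rw [abs_ne_zero, Int.cast_ne_zero]
  exact List.prod_ne_zero fun h => by
    obtain ⟨d, -, hd⟩ := List.mem_map.1 h
    exact L.terminusLabel_ne_zero hΓ d hd

theorem modulus_ne_zero (hΓ : Γ.IsGBS) (l : List (E × Bool)) : L.modulus l ≠ 0 :=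
  List.prod_ne_zero fun h => by
    obtain ⟨d, -, hd⟩ := List.mem_map.1 h
    rw [abs_eq_zero, div_eq_zero_iff, Int.cast_eq_zero, Int.cast_eq_zero] at hd
    exact hd.elim (L.originLabel_ne_zero hΓ d) (L.terminusLabel_ne_zero hΓ d)

theorem _root_.Rat.exists_common_denominator {ι : Type*} [Finite ι] (f : ι → ℚ) :
    ∃ M : ℤ, M ≠ 0 ∧ ∀ i, ∃ c : ℤ, (c : ℚ) = M * f i := by
  obtain ⟨M, hM⟩ := IsLocalization.exist_integer_multiples_of_finite (nonZeroDivisors ℤ) f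
  refine ⟨M, nonZeroDivisors.coe_ne_zero M, fun i => ?_⟩
  obtain ⟨c, hc⟩ := hM i
  exact ⟨c, by simpa using hc⟩

/-- In the unimodular case the vertex generators have nontrivial powers matched by the edges. -/
theorem exists_exponents_of_isUnimodular (hΓ : Γ.IsGBS) (hL : L.IsUnimodular) :
    ∃ N : V → ℤ, (∀ b, N b ≠ 0) ∧ ∀ e, ∃ c : ℤ, N (Γ.src e) = L.leftLabel e * c ∧
      (N (Γ.tgt e) = L.rightLabel e * c ∨ N (Γ.tgt e) = -(L.rightLabel e * c)) := by
  have := hΓ.finite_vertices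
  have := hΓ.finite_edges
  obtain ⟨a⟩ := hΓ.connected.1
  choose p hp using fun b => hΓ.connected.2 b a
  choose q hq using fun b => hΓ.connected.2 a b
  set ν : V → ℚ := fun b => L.modulus (p b) with hν
  have hν0 : ∀ b, ν b ≠ 0 := fun b => L.modulus_ne_zero hΓ _
  have hedge : ∀ e, ν (Γ.src e) = |(L.leftLabel e : ℚ) / L.rightLabel e| * ν (Γ.tgt e) := by
    intro e
    -- Two paths from `src e` to `a`, one through `e`, are closed up by the same return path.
    have h1 := L.modulus_eq_one_of_isUnimodular hΓ hL ((hp (Γ.src e)).append (hq (Γ.src e)))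
    have h2 := L.modulus_eq_one_of_isUnimodular hΓ hL
      ((IsPath.cons (e, true) _ _ (hp (Γ.tgt e))).append (hq (Γ.src e)))
    rw [modulus_append] at h1 h2
    exact mul_right_cancel₀ (L.modulus_ne_zero hΓ (q (Γ.src e))) (h1.trans h2.symm)
  -- Clearing `ν (src e) / leftLabel e` as well makes `N (src e)` divisible by the left label; the
  -- quotient `c e` then serves the target too.
  obtain ⟨M, hM, hint⟩ := Rat.exists_common_denominator
    (Sum.elim ν fun e => ν (Γ.src e) / L.leftLabel e)
  choose N hN using fun b => hint (Sum.inl b)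
  choose c hc using fun e => hint (Sum.inr e)
  simp only [Sum.elim_inl, Sum.elim_inr] at hN hc
  refine ⟨N, fun b hb => ?_, fun e => ⟨c e, ?_, ?_⟩⟩
  · have := hN b
    rw [hb, Int.cast_zero, eq_comm, mul_eq_zero, Int.cast_eq_zero] at this
    exact this.elim hM (hν0 b)
  · have hl : (L.leftLabel e : ℚ) ≠ 0 := by exact_mod_cast L.leftLabel_ne_zero hΓ e
    have : (N (Γ.src e) : ℚ) = L.leftLabel e * c e := by
      rw [hN, hc]
      field_simp
    exact_mod_cast this
  · have hl : (L.leftLabel e : ℚ) ≠ 0 := by exact_mod_cast L.leftLabel_ne_zero hΓ e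
    have hr : (L.rightLabel e : ℚ) ≠ 0 := by exact_mod_cast L.rightLabel_ne_zero hΓ e
    have : (N (Γ.tgt e) : ℚ) = L.rightLabel e * c e ∨
        (N (Γ.tgt e) : ℚ) = -(L.rightLabel e * c e) := by
      rw [hN, hc, hedge]
      rcases abs_choice ((L.leftLabel e : ℚ) / L.rightLabel e) with h | h <;> rw [h]
      · left; field_simp
      · right; field_simp
    exact_mod_cast this

/-- Equality matters here: in Baumslag–Solitar groups a cyclic subgroup can be conjugate to a proper
subgroup of itself. -/
theorem _root_.Subgroup.mem_normalizer_of_zpowers_conj {G : Type*} [Group G] {x g : G}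
    (h : Subgroup.zpowers (g⁻¹ * x * g) = Subgroup.zpowers x) :
    g ∈ Subgroup.normalizer (Subgroup.zpowers x : Set G) := by
  have hz : ∀ i : ℤ, (g⁻¹ * x * g) ^ i = g⁻¹ * x ^ i * g := fun i => by
    simpa using conj_zpow (a := g⁻¹) (b := x) (i := i)
  rw [← inv_mem_iff, Subgroup.mem_normalizer_iff]
  intro y
  rw [inv_inv]
  constructor
  · rintro ⟨i, rfl⟩
    rw [← h]
    exact ⟨i, hz i⟩
  · intro hy
    rw [← h] at hy
    obtain ⟨i, hi⟩ := hy
    have : x ^ i = y := mul_left_cancel (mul_right_cancel ((hz i).symm.trans hi))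
    exact ⟨i, this⟩

theorem exists_normal_of_isUnimodular (hΓ : Γ.IsGBS) {T : Set E} (hT : Γ.IsSpanningTree T)
    (hL : L.IsUnimodular) (a : V) :
    ∃ k : ℕ, 1 ≤ k ∧ (Subgroup.zpowers (L.gen T a ^ k)).Normal := by
  obtain ⟨N, hN, hedge⟩ := L.exists_exponents_of_isUnimodular hΓ hL
  have hconj : ∀ e, Subgroup.zpowers
      ((Γ.ofStable T e)⁻¹ * L.gen T (Γ.src e) ^ N (Γ.src e) * Γ.ofStable T e) =
        Subgroup.zpowers (L.gen T (Γ.tgt e) ^ N (Γ.tgt e)) := by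
    intro e
    obtain ⟨c, hs, ht | ht⟩ := hedge e <;> rw [hs, ht, L.conj_gen_zpow]
    rw [zpow_neg, Subgroup.zpowers_inv]
  have htree : ∀ e ∈ T, Subgroup.zpowers (L.gen T (Γ.src e) ^ N (Γ.src e)) =
      Subgroup.zpowers (L.gen T (Γ.tgt e) ^ N (Γ.tgt e)) := fun e he => by
    rw [← hconj e, ofStable_eq_one he, inv_one, one_mul, mul_one]
  have hpath : ∀ {b c : V} {l : List (E × Bool)}, Γ.IsPath b l c → (∀ d ∈ l, d.1 ∈ T) →
      Subgroup.zpowers (L.gen T b ^ N b) = Subgroup.zpowers (L.gen T c ^ N c) := by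
    intro b c l h
    induction h with
    | nil => exact fun _ => rfl
    | cons d l b _ ih =>
      intro hd
      rw [← ih fun d' h' => hd d' (List.mem_cons_of_mem _ h')]
      have he := htree d.1 (hd d List.mem_cons_self)
      obtain ⟨e, _ | _⟩ := d
      exacts [he.symm, he]
  have hall : ∀ b, Subgroup.zpowers (L.gen T b ^ N b) = Subgroup.zpowers (L.gen T a ^ N a) :=
    fun b => by
      obtain ⟨l, ⟨hl, -, hlT⟩, -⟩ := hT b a
      exact hpath hl hlT
  have hnormal : (Subgroup.zpowers (L.gen T a ^ N a)).Normal := by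
    rw [← Subgroup.normalizer_eq_top_iff, eq_top_iff]
    rintro g -
    refine mem_of_generators_mem (fun b y => ?_) (fun e => ?_) g
    -- Seen as `⟨x_b ^ N b⟩`, the subgroup is centralized by the vertex group at `b`, whose elements
    -- are powers of `x_b`.
    · rw [← hall b]
      refine Subgroup.mem_normalizer_of_zpowers_conj ?_
      obtain ⟨n, hn⟩ := Subgroup.mem_zpowers_iff.1 (L.ofVertex_mem_zpowers_gen T b y)
      rw [← hn, ← zpow_neg, ← zpow_add, ← zpow_add]
      congr 2
      ring
    · rw [← hall (Γ.src e)]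
      refine Subgroup.mem_normalizer_of_zpowers_conj ?_
      rw [hconj, hall, hall (Γ.src e)]
  refine ⟨(N a).natAbs, Int.natAbs_pos.2 (hN a), ?_⟩
  rcases Int.natAbs_eq (N a) with h | h
  · rwa [h, zpow_natCast] at hnormal
  · rwa [h, zpow_neg, Subgroup.zpowers_inv, zpow_natCast] at hnormal

end Labelling

end GraphOfGroups

theorem mainTheorem9 {V : Type u} {E : Type v} (Γ : GraphOfGroups.{u, v, w, z} V E)
    (hΓ : Γ.IsGBS) (T : Set E) (hT : Γ.IsSpanningTree T) (L : Γ.Labelling) (a : V) :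
    L.IsUnimodular ↔
      ∃ k : ℕ, 1 ≤ k ∧ (Subgroup.zpowers (Γ.ofVertex T a (L.vertexGen a) ^ k)).Normal :=
  ⟨fun h => L.exists_normal_of_isUnimodular hΓ hT h a,
    fun ⟨_, hk, hN⟩ => L.isUnimodular_of_normal hΓ hT hk hN⟩
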